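/- Time is slotted. In every slot one packet arrives at a sender; its importance is drawn i.i.d. from a finite set $\mathcal V=\{v_1<\dots<v_n\}\subset[0,\infty)$, $n\ge 2$, each level having positive probability; $v_{\min}=v_1$, $v_{\max}=v_n$. Independently of the arrivals, the sender may speak at times $T_1<T_2<\dots$ whose increments $Z_i$ ($T_0=0$) are i.i.d., integer valued, strictly positive, with $E[Z^2]<\infty$; $\mu=E[Z]$. Fix $\eta>0$ and a truncation level $M\ge 1$. Consider the following average-cost Markov decision problem. A state is a buffer $\mathbf b=(b_1,\dots,b_l)\in\mathcal V^{l}$, $1\le l\le M$ (oldest packet first). An action is an index $s\in\{1,\dots,l\}$ with $b_s\ne v_{\min}$ unless $s=l$: packet $s$ is sent, packets $1,\dots,s-1$ are lost, and the buffer at the next speaking time consists of the last $M$ entries of $(b_{s+1},\dots,b_l)$ followed by $Z$ new packets, the earlier entries being forgotten. The cost of the step is $\frac1\mu\sum_{k<s}b_k+\eta(l-s)$, plus $\frac1\mu$ times the total importance of the forgotten packets. Denote by $C_h(\mathbf b,s)$ the expected cost of the step, the packets forgotten up to the next speaking time included, plus the expectation of $h$ at the next buffer. A stationary policy $s^*$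 solves the Bellman equation if there are $\rho\in\mathbb R$ and a function $h$ such that for every state $\mathbf b$, $h(\mathbf b)+\rho=C_h(\mathbf b,s^*(\mathbf b))=\min_s C_h(\mathbf b,s)$, the minimum being over the allowed actions. Let $K(\eta)=\left\lceil\frac{v_{\max}-v_{\min}}{\mu\eta}\right\rceil$ and $K_i(\eta)=\left\lceil\frac{v_i-v_{\min}}{\mu\eta}\right\rceil$, and let $M\ge K(\eta)$. Then: (a) There is a stationary policy $s^*$ with buffer size $K(\eta)$, that is, one that keeps only the $K(\eta)$ most recent packets of the buffer, chooses one of them, and decides on the basis of them alone, such that $s^*$ is optimal for the problem truncated at level $M$: it solves its Bellman equation, and for every initial content of the buffer (in particular the empty one) its long-run average expected cost ($\limsup$ of the expected average cost of the first $N$ selections) is the smallest among all policies, including those that depend on all past arrivals and speaking times. Moreover, for every state $\mathbf b$ of length $l$, if $b_{s^*(\mathbf b)}=v_i$ with $v_i>v_{\min}$, then $l-s^*(\mathbf b)<K_i(\eta)$ (a packet of importance $v_{\min}$ is sent only with $s^*(\mathbf b)=l$). (b) For every stationary policy $s$ that solves the Bellman equation of the problem truncated at level $M$, and every state $\mathbf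 b$ of length $l$ with $b_{s(\mathbf b)}=v_i$, one has $l-s(\mathbf b)\le\frac{v_i-v_{\min}}{\mu\eta}$; hence, when $v_i>v_{\min}$, $l-s(\mathbf b)<K_i(\eta)$ except possibly when $l-s(\mathbf b)=\frac{v_i-v_{\min}}{\mu\eta}$ (a tie). -/

import Mathlib

noncomputable section

namespace AgeDistortion

/-- The data of the model. The importance levels are `v 0 < v 1 < ⋯ < v m`; packets carry the index
of their level. One packet arrives per time slot, its level having law `pV`; the levels are i.i.d.
and independent of the interspeaking times, which are i.i.d. with law `pZ`, strictly positive and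
square integrable. -/
structure Model (m : ℕ) where
  v : Fin (m + 1) → ℝ
  v_nonneg : ∀ i, 0 ≤ v i
  v_strictMono : StrictMono v
  pV : Fin (m + 1) → ℝ
  pV_pos : ∀ i, 0 < pV i
  pV_sum : ∑ i, pV i = 1
  pZ : ℕ → ℝ
  pZ_nonneg : ∀ z, 0 ≤ pZ z
  pZ_zero : pZ 0 = 0
  pZ_sum : HasSum pZ 1
  pZ_sq : Summable fun z : ℕ => (z : ℝ) ^ 2 * pZ z

/-- A buffer (or a block of arrivals): the list of the levels of its packets, oldest first. -/
abbrev Buffer (m : ℕ) := List (Fin (m + 1))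

/-- A buffer of length between `1` and `M`: a state of the problem truncated at level `M`. -/
def IsState {m : ℕ} (M : ℕ) (b : Buffer m) : Prop := b ≠ [] ∧ b.length ≤ M

/-- The `M` most recent packets of a buffer. -/
def recent {m : ℕ} (M : ℕ) (b : Buffer m) : Buffer m := b.drop (b.length - M)

/-- The packets that are forgotten when only the `M` most recent ones are kept. -/
def forgotten {m : ℕ} (M : ℕ) (b : Buffer m) : Buffer m := b.take (b.length - M)

/-- Action `s` (send the `s`-th oldest packet, counting from `1`) is allowed in `b`: it denotes a
packet of the buffer, and a packet of minimum importance is sent only if it is the freshest. -/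
def Admissible {m : ℕ} (b : Buffer m) (s : ℕ) : Prop :=
  1 ≤ s ∧ s ≤ b.length ∧ (s < b.length → b[s - 1]? ≠ some 0)

/-- A stationary policy that keeps only the `K` most recent packets and applies `σ` to them, written
as a policy on longer buffers. -/
def extend {m : ℕ} (K : ℕ) (σ : Buffer m → ℕ) (b : Buffer m) : ℕ :=
  (b.length - K) + σ (recent K b)

/-- A policy. The first argument is the list of all blocks of arrivals between consecutive speaking
times, the latest block first, so that it determines all past importance levels and all past
speaking times; the second argument is the current buffer. -/
abbrev Policy (m : ℕ) := List (Buffer m) → Buffer m → ℕ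

/-- The policy chooses an allowed action in every state of the problem truncated at level `M`. -/
def IsPolicy {m : ℕ} (M : ℕ) (π : Policy m) : Prop :=
  ∀ hist b, IsState M b → Admissible b (π hist b)

namespace Model

variable {m : ℕ} (P : Model m)

/-- The mean interspeaking time `μ`. -/
def mu : ℝ := ∑' z : ℕ, (z : ℝ) * P.pZ z

/-- The probability that the block of arrivals up to the next speaking time is `β`. -/
def blockProb (β : Buffer m) : ℝ := P.pZ β.length * (β.map P.pV).prod

/-- The expectation of `f` of the block of arrivals up to the next speaking time. -/
def blockMean (f : Buffer m → ℝ) : ℝ := ∑' β : Buffer m, P.blockProb β * f β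

/-- The total importance of a list of packets. -/
def importance (b : Buffer m) : ℝ := (b.map P.v).sum

/-- The one-step cost of action `s` in `b`: the distortion of the skipped packets, weighted by
`1 / μ`, plus `η` times the age of the selected packet. -/
def stageCost (η : ℝ) (b : Buffer m) (s : ℕ) : ℝ :=
  1 / P.mu * P.importance (b.take (s - 1)) + η * ((b.length : ℝ) - (s : ℝ))

/-- The right-hand side of the Bellman equation of the problem truncated at level `M`: the one-step
cost, plus the expected weighted importance of the packets forgotten until the next speaking time,
plus the expected relative value of the next buffer. -/
def bellmanRHS (M : ℕ) (η : ℝ) (h : Buffer m → ℝ) (b : Buffer m) (s : ℕ) : ℝ :=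
  P.stageCost η b s + P.blockMean fun β =>
    1 / P.mu * P.importance (forgotten M (b.drop s ++ β)) + h (recent M (b.drop s ++ β))

/-- The stationary policy `s` solves the Bellman equation of the problem truncated at level `M`:
with relative values `h` and average cost `ρ` it satisfies the evaluation equations, and in every
state its action minimizes the right-hand side over all allowed actions. -/
def BellmanOptimal (M : ℕ) (η : ℝ) (s : Buffer m → ℕ) : Prop :=
  ∃ (ρ : ℝ) (h : Buffer m → ℝ), ∀ b, IsState M b →
    Admissible b (s b) ∧
    h b + ρ = P.bellmanRHS M η h b (s b) ∧
    ∀ a, Admissible b a → P.bellmanRHS M η h b (s b) ≤ P.bellmanRHS M η h b a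

/-- The expected cost of the next `N` selections under the policy `π`, in the problem truncated at
level `M`, given the blocks that have arrived so far and the content `r` that the last selection
left in the buffer. -/
def expCost (M : ℕ) (η : ℝ) (π : Policy m) : ℕ → List (Buffer m) → Buffer m → ℝ
  | 0, _, _ => 0
  | N + 1, hist, r => P.blockMean fun β =>
      1 / P.mu * P.importance (forgotten M (r ++ β)) +
      P.stageCost η (recent M (r ++ β)) (π (β :: hist) (recent M (r ++ β))) +
      expCost M η π N (β :: hist)
        ((recent M (r ++ β)).drop (π (β :: hist) (recent M (r ++ β))))

/-- The long-run average expected cost of `π`, when the content of the buffer at time `0` is `r`. -/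
def avgCost (M : ℕ) (η : ℝ) (π : Policy m) (r : Buffer m) : EReal :=
  Filter.limsup (fun N : ℕ => ((P.expCost M η π N [] r / (N : ℝ) : ℝ) : EReal)) Filter.atTop

/-- The stationary policy `s` has the smallest long-run average cost among all (also non-stationary
and history-dependent) policies of the problem truncated at level `M`, for every initial content of
the buffer, in particular for the empty one. -/
def AverageOptimal (M : ℕ) (η : ℝ) (s : Buffer m → ℕ) : Prop :=
  IsPolicy M (fun _ b => s b) ∧
  ∀ r : Buffer m, r.length ≤ M → ∀ π : Policy m, IsPolicy M π →
    P.avgCost M η (fun _ b => s b) r ≤ P.avgCost M η π r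

/-- `K_i(η) = ⌈(v_i - v_min) / (μ η)⌉`. -/
def bufBound (η : ℝ) (i : Fin (m + 1)) : ℕ := ⌈1 / P.mu * ((P.v i - P.v 0) / η)⌉₊

/-- `K(η) = ⌈(v_max - v_min) / (μ η)⌉`. -/
def bufSize (η : ℝ) : ℕ := ⌈1 / P.mu * ((P.v (Fin.last m) - P.v 0) / η)⌉₊

end Model

end AgeDistortion

end

/-!
Sending a packet of importance `v` and age `a` earns the reward `v / μ - η a`, since paying for the
lost packets amounts to paying for all packets and being refunded for the sent ones. Measure rewards
relative to that of a fresh packet of minimum importance, which gives the `gain` of a packet. A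
packet of level `i` has positive gain if and only if its age is less than
`(v_i - v_min) / (μ η)`; gains decrease with age, and the freshest packet always has nonnegative
gain.

The core is a bound on the value of additional packets (`value_append_le`): having the packets `p` in
front of a nonempty buffer is worth at most the sum of the positive parts of their gains, their
`excess`. To see this, let a second sender without `p` imitate one that holds `p`. While the first
one sends packets of `p`, the second one sends its first packet of positive gain (or its freshest
packet), which then becomes an additional packet of the first sender, but yields less when it is sent
later. The imitation does not look into the future. In terms of a solution of the optimality equation
this is `exchange_step`; it shows that the largest violation of the bound over the finitely many
pairs of buffers cannot be positive, because with positive probability the next buffer ends with a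
packet of maximum importance, and there the exchange is strictly profitable.

Consequently (`exists_good_later`) an action that sends a packet of nonpositive gain which is not the
freshest is dominated by sending the first later packet of positive gain or the freshest one, and
strictly so if the gain is negative. This gives the age bound for every policy that solves the
Bellman equation. It also shows that a solution of the optimality equation at level `K(η)` remains a
solution at every larger level when the older packets are ignored (`SolvesOptimality.extend`), and
that the maximum is attained by actions with the strict age bound (`exists_good_action`).

A solution at level `K(η)` exists by the vanishing discount method
(`exists_solvesOptimality`): the discounted problems are solved by value iteration, and the bound on
the value of additional packets, which holds uniformly in the discount factor, makes their relative
values bounded. Finally, a policy that solves the Bellman equation is average optimal by the usual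
verification argument (`BellmanOptimal.averageOptimal`).
-/

noncomputable section

namespace AgeDistortion

open Filter Topology

variable {m : ℕ}

/-! ### Buffers and blocks of arrivals -/

lemma recent_length (L : ℕ) (b : Buffer m) : (recent L b).length = min L b.length := by
  simp [recent]; omega

lemma recent_of_length_le {L : ℕ} {b : Buffer m} (h : b.length ≤ L) : recent L b = b := by
  simp [recent, Nat.sub_eq_zero_of_le h]

lemma forgotten_append_recent (L : ℕ) (b : Buffer m) : forgotten L b ++ recent L b = b :=
  List.take_append_drop _ _

lemma recent_append (L : ℕ) (p c : Buffer m) :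
    recent L (p ++ c) = p.drop (p.length + c.length - L) ++ recent L c := by
  simp only [recent, List.length_append, List.drop_append]
  congr 2
  omega

lemma recent_recent {K M : ℕ} (h : K ≤ M) (b : Buffer m) : recent K (recent M b) = recent K b := by
  simp only [recent, List.drop_drop, List.length_drop]
  congr 1
  omega

lemma recent_append_of_length_le {K : ℕ} (p c : Buffer m) (h : c.length ≤ K) :
    ∃ p', recent K (p ++ c) = p' ++ c :=
  ⟨_, by rw [recent_append, recent_of_length_le h]⟩

lemma recent_ne_nil {L : ℕ} (hL : 1 ≤ L) {b : Buffer m} (hb : b ≠ []) : recent L b ≠ [] := by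
  have := List.length_pos_of_ne_nil hb
  apply List.ne_nil_of_length_pos
  rw [recent_length]; omega

lemma isState_recent {L : ℕ} (hL : 1 ≤ L) {b : Buffer m} (hb : b ≠ []) : IsState L (recent L b) :=
  ⟨recent_ne_nil hL hb, by rw [recent_length]; omega⟩

/-- An action is the same thing as a decomposition of the buffer into the skipped packets, the
selected packet and the remaining packets. -/
lemma admissible_iff {b : Buffer m} {s : ℕ} :
    Admissible b s ↔ ∃ p x r, b = p ++ x :: r ∧ s = p.length + 1 ∧ (r ≠ [] → x ≠ 0) := by
  constructor
  · rintro ⟨h1, h2, h3⟩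
    have hlt : s - 1 < b.length := by omega
    refine ⟨b.take (s - 1), b[s - 1], b.drop s, ?_, ?_, ?_⟩
    · have := List.take_append_drop (s - 1) b
      rw [List.drop_eq_getElem_cons hlt, Nat.sub_add_cancel h1] at this
      exact this.symm
    · simp; omega
    · intro hr hx
      have hs : s < b.length := by
        by_contra hcon
        exact hr (List.drop_eq_nil_of_le (by omega))
      exact h3 hs (by rw [List.getElem?_eq_getElem hlt, hx])
  · rintro ⟨p, x, r, rfl, rfl, h⟩
    refine ⟨by omega, by simp, fun hs => ?_⟩
    have : r ≠ [] := by rintro rfl; simp at hs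
    simpa using h this

/-- A function on buffers is bounded on the buffers of bounded length, these being finitely many. -/
lemma exists_bound (L : ℕ) (G : Buffer m → ℝ) : ∃ C, ∀ b, b.length ≤ L → |G b| ≤ C := by
  have hf : {b : Buffer m | b.length ≤ L}.Finite := List.finite_length_le _ _
  obtain ⟨C, hC⟩ := (hf.image fun b => |G b|).bddAbove
  exact ⟨C, fun b hb => hC ⟨b, hb, rfl⟩⟩

namespace Model
variable (P : Model m)

lemma blockProb_nonneg (β : Buffer m) : 0 ≤ P.blockProb β := by
  refine mul_nonneg (P.pZ_nonneg _) (List.prod_nonneg ?_)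
  intro a ha
  obtain ⟨i, -, rfl⟩ := List.mem_map.1 ha
  exact (P.pV_pos i).le

@[simp] lemma blockProb_nil : P.blockProb [] = 0 := by simp [blockProb, P.pZ_zero]

/-- The length of a block of arrivals has law `pZ`. -/
lemma hasSum_blockProb_mul {g : ℕ → ℝ} (hg : ∀ n, 0 ≤ g n)
    (h : Summable fun n => P.pZ n * g n) :
    HasSum (fun β : Buffer m => P.blockProb β * g β.length) (∑' n, P.pZ n * g n) := by
  have key : ∀ n, HasSum
      (fun t : Fin n → Fin (m + 1) => P.blockProb (List.ofFn t) * g (List.ofFn t).length)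
      (P.pZ n * g n) := by
    intro n
    have : P.pZ n * g n
        = ∑ t : Fin n → Fin (m + 1), P.blockProb (List.ofFn t) * g (List.ofFn t).length := by
      have h1 := Fintype.sum_pow P.pV n
      rw [P.pV_sum, one_pow] at h1
      simp only [blockProb, List.length_ofFn, List.map_ofFn, List.prod_ofFn, Function.comp_apply]
      rw [← Finset.sum_mul, ← Finset.mul_sum, ← h1, mul_one]
    rw [this]
    exact hasSum_fintype _
  rw [← (List.equivSigmaTuple (α := Fin (m + 1))).symm.hasSum_iff]
  have hs : Summable ((fun β : Buffer m => P.blockProb β * g β.length) ∘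
      (List.equivSigmaTuple (α := Fin (m + 1))).symm) := by
    refine (summable_sigma_of_nonneg fun x => mul_nonneg (P.blockProb_nonneg _) (hg _)).2
      ⟨fun n => (key n).summable, ?_⟩
    refine h.congr fun n => ?_
    exact ((key n).tsum_eq).symm
  have h2 := hs.hasSum.sigma (fun n => key n)
  rw [h2.tsum_eq]
  exact hs.hasSum

lemma summable_id_mul_pZ : Summable fun z : ℕ => (z : ℝ) * P.pZ z := by
  refine P.pZ_sq.of_nonneg_of_le (fun z => mul_nonneg (by positivity) (P.pZ_nonneg z)) fun z => ?_
  refine mul_le_mul_of_nonneg_right ?_ (P.pZ_nonneg z)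
  exact_mod_cast Nat.le_self_pow two_ne_zero z

lemma mu_pos : 0 < P.mu := by
  have : (1 : ℝ) ≤ P.mu := by
    rw [← P.pZ_sum.tsum_eq]
    refine P.pZ_sum.summable.tsum_le_tsum (fun z => ?_) P.summable_id_mul_pZ
    rcases Nat.eq_zero_or_pos z with rfl | hz
    · simp [P.pZ_zero]
    · exact le_mul_of_one_le_left (P.pZ_nonneg z) (by exact_mod_cast hz)
  linarith

lemma hasSum_blockProb : HasSum P.blockProb 1 := by
  have := P.hasSum_blockProb_mul (g := fun _ => 1) (fun _ => zero_le_one)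
    (by simpa using P.pZ_sum.summable)
  simpa [P.pZ_sum.tsum_eq] using this

/-- `f` of the block of arrivals is integrable. -/
def BlockSummable (f : Buffer m → ℝ) : Prop := Summable fun β => P.blockProb β * f β

variable {P}

lemma BlockSummable.of_le {f : Buffer m → ℝ} (a b : ℝ)
    (h : ∀ β, β ≠ [] → |f β| ≤ a + b * β.length) :
    P.BlockSummable f := by
  have h1 := P.hasSum_blockProb_mul (g := fun n => (n : ℝ)) (fun _ => by positivity)
    (P.summable_id_mul_pZ.congr fun n => mul_comm _ _)
  have h2 := (P.hasSum_blockProb.summable.mul_right a).add (h1.summable.mul_right b)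
  refine Summable.of_norm_bounded h2 fun β => ?_
  rcases eq_or_ne β [] with rfl | hβ
  · simp
  rw [Real.norm_eq_abs, abs_mul, abs_of_nonneg (P.blockProb_nonneg β)]
  calc _ ≤ P.blockProb β * (a + b * β.length) :=
        mul_le_mul_of_nonneg_left (h β hβ) (P.blockProb_nonneg β)
    _ = _ := by ring

lemma BlockSummable.of_bounded {f : Buffer m → ℝ} (a : ℝ) (h : ∀ β, |f β| ≤ a) :
    P.BlockSummable f :=
  .of_le a 0 fun β _ => by simpa using h β

lemma BlockSummable.const (a : ℝ) : P.BlockSummable fun _ => a := .of_bounded |a| fun _ => le_rfl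

lemma BlockSummable.add {f g : Buffer m → ℝ} (hf : P.BlockSummable f) (hg : P.BlockSummable g) :
    P.BlockSummable fun β => f β + g β :=
  (Summable.add hf hg).congr fun β => by ring

lemma BlockSummable.sub {f g : Buffer m → ℝ} (hf : P.BlockSummable f) (hg : P.BlockSummable g) :
    P.BlockSummable fun β => f β - g β :=
  (Summable.sub hf hg).congr fun β => by ring

lemma blockMean_add {f g : Buffer m → ℝ} (hf : P.BlockSummable f) (hg : P.BlockSummable g) :
    P.blockMean (fun β => f β + g β) = P.blockMean f + P.blockMean g := by
  unfold blockMean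
  rw [← Summable.tsum_add hf hg]
  exact tsum_congr fun β => by ring

lemma blockMean_sub {f g : Buffer m → ℝ} (hf : P.BlockSummable f) (hg : P.BlockSummable g) :
    P.blockMean (fun β => f β - g β) = P.blockMean f - P.blockMean g := by
  unfold blockMean
  rw [← Summable.tsum_sub hf hg]
  exact tsum_congr fun β => by ring

variable (P) in
@[simp] lemma blockMean_const (a : ℝ) : P.blockMean (fun _ => a) = a := by
  unfold blockMean
  rw [tsum_mul_right, P.hasSum_blockProb.tsum_eq, one_mul]

lemma blockMean_congr {f g : Buffer m → ℝ} (h : ∀ β, β ≠ [] → f β = g β) :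
    P.blockMean f = P.blockMean g := by
  refine tsum_congr fun β => ?_
  rcases eq_or_ne β [] with rfl | hβ
  · simp
  · rw [h β hβ]

lemma blockMean_mono {f g : Buffer m → ℝ} (hf : P.BlockSummable f) (hg : P.BlockSummable g)
    (h : ∀ β, β ≠ [] → f β ≤ g β) : P.blockMean f ≤ P.blockMean g := by
  refine Summable.tsum_le_tsum (fun β => ?_) hf hg
  rcases eq_or_ne β [] with rfl | hβ
  · simp
  · exact mul_le_mul_of_nonneg_left (h β hβ) (P.blockProb_nonneg β)

lemma blockMean_lt {f g : Buffer m → ℝ} (hf : P.BlockSummable f) (hg : P.BlockSummable g)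
    (h : ∀ β, β ≠ [] → f β ≤ g β) {β₀ : Buffer m} (h0 : 0 < P.blockProb β₀)
    (hlt : f β₀ < g β₀) : P.blockMean f < P.blockMean g := by
  refine Summable.tsum_lt_tsum (i := β₀) (fun β => ?_) (mul_lt_mul_of_pos_left hlt h0) hf hg
  rcases eq_or_ne β [] with rfl | hβ
  · simp
  · exact mul_le_mul_of_nonneg_left (h β hβ) (P.blockProb_nonneg β)

variable (P)

/-- With positive probability all packets of a block have the highest importance. -/
lemma exists_block_last : ∃ z : ℕ, 1 ≤ z ∧ 0 < P.blockProb (List.replicate z (Fin.last m)) := by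
  obtain ⟨z, hz⟩ : ∃ z, P.pZ z ≠ 0 := by
    by_contra! h
    have := P.pZ_sum
    rw [show P.pZ = fun _ => 0 from funext h] at this
    exact zero_ne_one (hasSum_zero.unique this)
  refine ⟨z, Nat.one_le_iff_ne_zero.2 fun h => hz (h ▸ P.pZ_zero), ?_⟩
  have h1 : 0 < P.pZ z := lt_of_le_of_ne (P.pZ_nonneg z) (Ne.symm hz)
  simpa [blockProb] using mul_pos h1 (pow_pos (P.pV_pos (Fin.last m)) z)

/-! ### Importance -/

lemma importance_append (b c : Buffer m) :
    P.importance (b ++ c) = P.importance b + P.importance c := by simp [importance]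

lemma importance_nonneg (b : Buffer m) : 0 ≤ P.importance b := by
  refine List.sum_nonneg fun a ha => ?_
  obtain ⟨i, -, rfl⟩ := List.mem_map.1 ha
  exact P.v_nonneg i

lemma importance_le (b : Buffer m) : P.importance b ≤ P.v (Fin.last m) * b.length := by
  have := List.sum_le_card_nsmul (b.map P.v) (P.v (Fin.last m)) (by
    intro x hx
    obtain ⟨i, -, rfl⟩ := List.mem_map.1 hx
    exact P.v_strictMono.monotone (Fin.le_last i))
  simpa [importance, mul_comm] using this

lemma importance_forgotten_add (L : ℕ) (b : Buffer m) :
    P.importance (forgotten L b) + P.importance (recent L b) = P.importance b := by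
  rw [← importance_append, forgotten_append_recent]

end Model

/-! ### Rewards and excess -/

namespace Model
variable (P : Model m)

/-- The reward of sending a packet of level `x` and age `a`: its weighted importance minus `η` times
its age, relative to the reward of a fresh packet of minimum importance. -/
def gain (η : ℝ) (x : Fin (m + 1)) (a : ℕ) : ℝ := 1 / P.mu * (P.v x - P.v 0) - η * a

/-- The expectation of `G` at the next buffer (of which `L` packets are kept), if `r` is what the
current selection leaves in the buffer. -/
def contValue (L : ℕ) (G : Buffer m → ℝ) (r : Buffer m) : ℝ :=
  P.blockMean fun β => G (recent L (r ++ β))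

/-- `G` solves, with constant `c`, the optimality equation with discount factor `α` of the problem
truncated at level `L`, in the form in which rewards are maximized. An action is a decomposition
`p ++ x :: r` of the buffer. For `α = 1` this is the average-reward equation. -/
structure SolvesOptimality (η : ℝ) (α : ℝ) (L : ℕ) (G : Buffer m → ℝ) (c : ℝ) : Prop where
  le : ∀ p x r, IsState L (p ++ x :: r) → (r ≠ [] → x ≠ 0) →
    P.gain η x r.length + α * P.contValue L G r ≤ G (p ++ x :: r) + c
  attained : ∀ b, IsState L b → ∃ p x r, b = p ++ x :: r ∧ (r ≠ [] → x ≠ 0) ∧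
    G b + c = P.gain η x r.length + α * P.contValue L G r

/-- The sum of the positive parts of the gains of the packets in `p`, when `a` more packets have
arrived after `p`. It bounds the advantage of having the packets `p` in the buffer. -/
def excess (η : ℝ) (a : ℕ) : Buffer m → ℝ
  | [] => 0
  | x :: p => max 0 (P.gain η x (p.length + a)) + excess η a p

variable {P} {η : ℝ}

lemma gain_antitone (hη : 0 < η) (x : Fin (m + 1)) {a a' : ℕ} (h : a ≤ a') :
    P.gain η x a' ≤ P.gain η x a := by
  have : (a : ℝ) ≤ a' := by exact_mod_cast h
  unfold gain
  nlinarith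

lemma gain_succ (x : Fin (m + 1)) (a : ℕ) : P.gain η x (a + 1) = P.gain η x a - η := by
  unfold gain
  push_cast
  ring

lemma gain_zero_nonneg (x : Fin (m + 1)) : 0 ≤ P.gain η x 0 := by
  have := P.v_strictMono.monotone (Fin.zero_le x)
  have := P.mu_pos
  simp only [gain, Nat.cast_zero, mul_zero, sub_zero]
  exact mul_nonneg (by positivity) (by linarith)

lemma gain_zero_pos {x : Fin (m + 1)} (hx : x ≠ 0) : 0 < P.gain η x 0 := by
  have := P.v_strictMono (Fin.pos_iff_ne_zero.2 hx)
  have := P.mu_pos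
  simp only [gain, Nat.cast_zero, mul_zero, sub_zero]
  exact mul_pos (by positivity) (by linarith)

lemma gain_le (hη : 0 < η) (x : Fin (m + 1)) (a : ℕ) :
    P.gain η x a ≤ P.gain η (Fin.last m) 0 := by
  refine (gain_antitone hη x (Nat.zero_le a)).trans ?_
  have := P.v_strictMono.monotone (Fin.le_last x)
  have := P.mu_pos
  unfold gain
  gcongr

lemma ne_zero_of_gain_pos (hη : 0 < η) {x : Fin (m + 1)} {a : ℕ} (h : 0 < P.gain η x a) :
    x ≠ 0 := by
  rintro rfl
  have : (0 : ℝ) ≤ η * a := by positivity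
  simp only [gain, sub_self, mul_zero] at h
  linarith

lemma excess_nonneg (a : ℕ) (p : Buffer m) : 0 ≤ P.excess η a p := by
  induction p with
  | nil => exact le_rfl
  | cons x p ih => exact add_nonneg (le_max_left _ _) ih

lemma excess_antitone (hη : 0 < η) {a a' : ℕ} (h : a ≤ a') (p : Buffer m) :
    P.excess η a' p ≤ P.excess η a p := by
  induction p with
  | nil => exact le_rfl
  | cons x p ih => exact add_le_add (max_le_max le_rfl (gain_antitone hη x (by omega))) ih

lemma excess_append (a : ℕ) (p q : Buffer m) :
    P.excess η a (p ++ q) = P.excess η (q.length + a) p + P.excess η a q := by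
  induction p with
  | nil => simp [excess]
  | cons x p ih =>
    simp only [List.cons_append, excess, ih, List.length_append]
    rw [add_assoc p.length]
    ring

lemma excess_drop_le (a k : ℕ) (p : Buffer m) : P.excess η a (p.drop k) ≤ P.excess η a p := by
  conv_rhs => rw [← List.take_append_drop k p, excess_append]
  linarith [excess_nonneg (P := P) (η := η) ((p.drop k).length + a) (p.take k)]

lemma excess_le (hη : 0 < η) (a : ℕ) (p : Buffer m) :
    P.excess η a p ≤ P.gain η (Fin.last m) 0 * p.length := by
  induction p with
  | nil => simp [excess]
  | cons x p ih =>
    have := max_le (gain_zero_nonneg (P := P) (η := η) (Fin.last m)) (gain_le hη x (p.length + a))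
    simp only [excess, List.length_cons]
    push_cast
    linarith

/-- When only the `L` most recent packets are kept, the packets of `p` that survive the arrival of a
nonempty block have at most the excess they have at age one more. -/
lemma excess_surviving_le (hη : 0 < η) (L : ℕ) (p r β : Buffer m) (hβ : β ≠ []) :
    P.excess η (recent L (r ++ β)).length (p.drop (p.length + (r ++ β).length - L))
      ≤ P.excess η (r.length + 1) p := by
  have hpos := List.length_pos_of_ne_nil hβ
  rcases le_or_gt (r ++ β).length L with h | h
  · rw [recent_of_length_le h]
    refine (excess_antitone hη ?_ _).trans (excess_drop_le _ _ _)
    simp; omega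
  · rw [List.drop_eq_nil_of_le (by omega)]
    exact excess_nonneg _ _

lemma blockSummable_recent (L : ℕ) (G : Buffer m → ℝ) (r : Buffer m) :
    P.BlockSummable fun β => G (recent L (r ++ β)) := by
  obtain ⟨C, hC⟩ := exists_bound L G
  exact .of_bounded C fun β => hC _ (by rw [recent_length]; omega)

/-- Every nonempty buffer contains a packet `y` that has positive gain or is the freshest, such that
no older packet has positive gain. -/
lemma exists_first_positive {c : Buffer m} (hc : c ≠ []) :
    ∃ q y r, c = q ++ y :: r ∧ (0 < P.gain η y r.length ∨ r = []) ∧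
      P.excess η (r.length + 1) q = 0 := by
  induction c with
  | nil => exact absurd rfl hc
  | cons z c ih =>
    by_cases h : 0 < P.gain η z c.length ∨ c = []
    · exact ⟨[], z, c, rfl, h, rfl⟩
    · push Not at h
      obtain ⟨q, y, r, rfl, h1, h2⟩ := ih h.2
      refine ⟨z :: q, y, r, rfl, h1, ?_⟩
      have h3 := h.1
      simp only [List.length_append, List.length_cons] at h3
      simp only [excess, h2, add_zero]
      exact max_eq_left h3

lemma gain_nonneg_of_good {y : Fin (m + 1)} {r : Buffer m}
    (h : 0 < P.gain η y r.length ∨ r = []) : 0 ≤ P.gain η y r.length := by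
  rcases h with h | rfl
  · exact h.le
  · exact gain_zero_nonneg y

lemma ne_zero_of_good (hη : 0 < η) {y : Fin (m + 1)} {r : Buffer m}
    (h : 0 < P.gain η y r.length ∨ r = []) (hr : r ≠ []) : y ≠ 0 :=
  ne_zero_of_gain_pos hη (h.resolve_right hr)

/-! ### The value of additional packets -/

/-- A bound on the advantage of additional packets carries over from the values to the continuation
values. -/
lemma contValue_append_le (hη : 0 < η) {L : ℕ} (hL : 1 ≤ L) {G : Buffer m → ℝ} {D : ℝ}
    (hD : ∀ p c, c ≠ [] → (p ++ c).length ≤ L → G (p ++ c) - G c ≤ D + P.excess η c.length p)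
    (p r : Buffer m) :
    P.contValue L G (p ++ r) ≤ P.contValue L G r + (D + P.excess η (r.length + 1) p) := by
  have hs := (blockSummable_recent (P := P) L G r).add
    (.const (D + P.excess η (r.length + 1) p))
  have := blockMean_mono (blockSummable_recent (P := P) L G (p ++ r)) hs fun β hβ => by
    have h1 := hD (p.drop (p.length + (r ++ β).length - L)) (recent L (r ++ β))
      (recent_ne_nil hL (by simp [hβ])) (by rw [← recent_append, recent_length]; omega)
    rw [List.append_assoc, recent_append]
    linarith [excess_surviving_le (P := P) hη L p r β hβ]
  rwa [blockMean_add (blockSummable_recent L G r) (.const _), blockMean_const] at this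

/-- A strict form of `contValue_append_le`: it is enough to have strict inequality for the buffers
whose freshest packet has the highest importance, as such a buffer comes next with positive
probability. -/
lemma contValue_append_lt (hη : 0 < η) {L : ℕ} (hL : 1 ≤ L) {G : Buffer m → ℝ} {D : ℝ}
    (hD : ∀ p c, c ≠ [] → (p ++ c).length ≤ L → G (p ++ c) - G c ≤ D + P.excess η c.length p)
    (hD' : ∀ p c, (p ++ (c ++ [Fin.last m])).length ≤ L →
      G (p ++ (c ++ [Fin.last m])) - G (c ++ [Fin.last m])
        < D + P.excess η (c ++ [Fin.last m]).length p)
    (p r : Buffer m) :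
    P.contValue L G (p ++ r) < P.contValue L G r + (D + P.excess η (r.length + 1) p) := by
  have hs := (blockSummable_recent (P := P) L G r).add
    (.const (D + P.excess η (r.length + 1) p))
  obtain ⟨z, hz, hpos⟩ := P.exists_block_last
  have := blockMean_lt (blockSummable_recent (P := P) L G (p ++ r)) hs (fun β hβ => by
    have h1 := hD (p.drop (p.length + (r ++ β).length - L)) (recent L (r ++ β))
      (recent_ne_nil hL (by simp [hβ])) (by rw [← recent_append, recent_length]; omega)
    rw [List.append_assoc, recent_append]
    linarith [excess_surviving_le (P := P) hη L p r β hβ]) hpos (by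
    set β := List.replicate z (Fin.last m) with hβ
    have hne : β ≠ [] := by
      rw [hβ, Ne, List.replicate_eq_nil_iff]
      omega
    obtain ⟨c, hc⟩ : ∃ c, recent L (r ++ β) = c ++ [Fin.last m] := by
      obtain ⟨k, rfl⟩ : ∃ k, z = k + 1 := ⟨z - 1, by omega⟩
      rw [hβ, List.replicate_succ', ← List.append_assoc]
      exact recent_append_of_length_le _ _ (by simpa using hL)
    have h1 := hD' (p.drop (p.length + (r ++ β).length - L)) c
      (by rw [← hc, ← recent_append, recent_length]; omega)
    rw [← hc] at h1
    rw [List.append_assoc, recent_append]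
    linarith [excess_surviving_le (P := P) hη L p r β hne])
  rwa [blockMean_add (blockSummable_recent L G r) (.const _), blockMean_const] at this

/-- The exchange step. Let one sender hold `p ++ c` and another only `c`. While the first one sends a
packet of `p`, the second one sends the first packet of `c` with positive gain, or the freshest.
The advantage of the first one then reduces to that of having the additional packets `p'`
after the selection, minus the amount `κ` by which the gain of the second sender's packet exceeds
what that packet could still yield to the first one. -/
lemma exchange_step (hη : 0 < η) {α : ℝ} (h1 : α ≤ 1) {L : ℕ} {G : Buffer m → ℝ}
    {k : ℝ} (hG : P.SolvesOptimality η α L G k) {p c : Buffer m} (hc : c ≠ [])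
    (hlen : (p ++ c).length ≤ L) :
    G (p ++ c) - G c ≤ P.excess η c.length p ∨
    ∃ p' r κ, 0 ≤ κ ∧ (∀ c', c = c' ++ [Fin.last m] → 0 < P.gain η (Fin.last m) 0 → 0 < κ) ∧
      G (p ++ c) - G c ≤ P.excess η c.length p - κ +
        α * (P.contValue L G (p' ++ r) - P.contValue L G r - P.excess η (r.length + 1) p') := by
  obtain ⟨p₁, x, t, hb, hx, hval⟩ := hG.attained (p ++ c) ⟨by simp [hc], hlen⟩
  have hcL : c.length ≤ L := by simp at hlen; omega
  rcases List.append_eq_append_iff.1 hb with ⟨s, hs, hs'⟩ | ⟨s, hs, hs'⟩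
  · -- The selected packet belongs to `c`: the same action is available in `c`.
    left
    subst hs'
    have := hG.le s x t ⟨by simp, hcL⟩ hx
    linarith [excess_nonneg (P := P) (η := η) (s ++ x :: t).length p]
  · rcases s with _ | ⟨x', p₂⟩
    · left
      simp only [List.nil_append] at hs'
      subst hs'
      have := hG.le [] x t ⟨by simp, hcL⟩ hx
      simp only [List.nil_append] at this
      linarith [excess_nonneg (P := P) (η := η) (x :: t).length p]
    · right
      simp only [List.cons_append, List.cons.injEq] at hs'
      obtain ⟨rfl, rfl⟩ := hs'
      obtain ⟨q, y, r, rfl, hy, hq⟩ := exists_first_positive (P := P) (η := η) hc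
      have hy0 := gain_nonneg_of_good hy
      refine ⟨p₂ ++ q ++ [y], r,
        P.gain η y r.length - max 0 (P.gain η y (r.length + 1)), ?_, ?_, ?_⟩
      · rw [gain_succ]
        exact sub_nonneg.2 (max_le hy0 (by linarith))
      · intro c' hc' hlast
        have hpos : 0 < P.gain η y r.length := by
          rcases hy with hy | rfl
          · exact hy
          · have := (List.append_inj' hc' rfl).2
            simp only [List.cons.injEq, and_true] at this
            subst this
            exact hlast
        rw [gain_succ]
        exact sub_pos.2 (max_lt hpos (by linarith))
      · have hle := hG.le q y r ⟨by simp, hcL⟩ (ne_zero_of_good hη hy)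
        have e1 : P.excess η (q ++ y :: r).length (p₁ ++ x :: p₂) =
            P.excess η ((x :: p₂).length + (q ++ y :: r).length) p₁ +
            (max 0 (P.gain η x (p₂ ++ (q ++ y :: r)).length) +
              P.excess η (q ++ y :: r).length p₂) := by
          rw [excess_append, List.length_append (as := p₂)]
          rfl
        have e2 : P.excess η (r.length + 1) (p₂ ++ q ++ [y]) ≤
            P.excess η (q ++ y :: r).length p₂ + max 0 (P.gain η y (r.length + 1)) := by
          rw [excess_append, excess_append]
          have h2 := excess_antitone (P := P) hη
            (show r.length + 1 ≤ [y].length + (r.length + 1) by simp) q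
          have h3 := excess_antitone (P := P) hη
            (show (q ++ y :: r).length ≤ q.length + ([y].length + (r.length + 1)) by simp) p₂
          simp only [excess, List.length_nil, zero_add, add_zero]
          linarith
        have e3 := excess_nonneg (P := P) (η := η) (r.length + 1) (p₂ ++ q ++ [y])
        have e4 := excess_nonneg (P := P) (η := η) ((x :: p₂).length + (q ++ y :: r).length) p₁
        have e5 := le_max_right 0 (P.gain η x (p₂ ++ (q ++ y :: r)).length)
        have e6 : α * P.excess η (r.length + 1) (p₂ ++ q ++ [y])
            ≤ P.excess η (r.length + 1) (p₂ ++ q ++ [y]) := mul_le_of_le_one_left e3 h1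
        have e7 : p₂ ++ q ++ [y] ++ r = p₂ ++ (q ++ y :: r) := by simp
        rw [← hs] at e1
        rw [e7, mul_sub, mul_sub]
        linarith

/-- Having the additional packets `p` in front of a nonempty buffer `c` is worth at most their
excess. -/
theorem value_append_le (hm : 1 ≤ m) (hη : 0 < η) {α : ℝ} (h0 : 0 ≤ α) (h1 : α ≤ 1) {L : ℕ}
    (hL : 1 ≤ L) {G : Buffer m → ℝ} {k : ℝ} (hG : P.SolvesOptimality η α L G k)
    (p c : Buffer m) (hc : c ≠ []) (hlen : (p ++ c).length ≤ L) :
    G (p ++ c) - G c ≤ P.excess η c.length p := by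
  have hlast : 0 < P.gain η (Fin.last m) 0 :=
    gain_zero_pos (by rw [Ne, Fin.ext_iff]; simp; omega)
  -- Let `D` be the largest violation of the claim; it is attained, as there are finitely many pairs.
  let S : Set (Buffer m × Buffer m) := {x | x.2 ≠ [] ∧ (x.1 ++ x.2).length ≤ L}
  have hSf : S.Finite := by
    refine ((List.finite_length_le (Fin (m + 1)) L).prod
      (List.finite_length_le (Fin (m + 1)) L)).subset ?_
    rintro ⟨a, b⟩ ⟨-, h⟩
    simp only [List.length_append] at h
    exact ⟨show a.length ≤ L by omega, show b.length ≤ L by omega⟩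
  obtain ⟨⟨p₀, c₀⟩, ⟨hc₀, hlen₀⟩, hmax⟩ := S.exists_max_image
    (fun x => G (x.1 ++ x.2) - G x.2 - P.excess η x.2.length x.1) hSf ⟨(p, c), hc, hlen⟩
  set D := G (p₀ ++ c₀) - G c₀ - P.excess η c₀.length p₀ with hDdef
  have hle : ∀ p c, c ≠ [] → (p ++ c).length ≤ L →
      G (p ++ c) - G c ≤ D + P.excess η c.length p := fun p c hc hl => by
    have := hmax (p, c) ⟨hc, hl⟩
    simp only at this
    linarith
  suffices D ≤ 0 by linarith [hle p c hc hlen]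
  by_contra! hD
  -- After an exchange the violation is at most `D` on average, so if `D > 0`, it is smaller than `D`
  -- wherever the second sender's packet has positive gain, as it has when the freshest packet has the
  -- highest importance.
  have hlt : ∀ p c, (p ++ (c ++ [Fin.last m])).length ≤ L →
      G (p ++ (c ++ [Fin.last m])) - G (c ++ [Fin.last m])
        < D + P.excess η (c ++ [Fin.last m]).length p := by
    intro p c hl
    rcases exchange_step hη h1 hG (by simp) hl with h | ⟨p', r, κ, -, hκ, h⟩
    · linarith
    · have := hκ c rfl hlast
      have := contValue_append_le hη hL hle p' r
      nlinarith
  -- For `α = 1` and `κ = 0` the contradiction comes from the following step, in which such buffers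
  -- have positive probability.
  rcases exchange_step hη h1 hG hc₀ hlen₀ with h | ⟨p', r, κ, hκ, -, h⟩
  · linarith
  · have := contValue_append_lt hη hL hle hlt p' r
    rcases h0.eq_or_lt with rfl | h0
    · linarith
    · nlinarith

lemma contValue_append_le_excess (hm : 1 ≤ m) (hη : 0 < η) {α : ℝ} (h0 : 0 ≤ α) (h1 : α ≤ 1)
    {L : ℕ} (hL : 1 ≤ L) {G : Buffer m → ℝ} {k : ℝ} (hG : P.SolvesOptimality η α L G k)
    (p r : Buffer m) :
    P.contValue L G (p ++ r) ≤ P.contValue L G r + P.excess η (r.length + 1) p := by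
  have := contValue_append_le (P := P) (G := G) hη hL (D := 0) (fun p c hc hl => by
    linarith [value_append_le hm hη h0 h1 hL hG p c hc hl]) p r
  linarith

/-- Keeping the packets `t` is worth at most as much as a selection that sends the first packet of
`t` that has positive gain or is the freshest: the older packets of `t` have no excess, and keeping
`y` itself is worth at most its gain. Hence sending a packet of nonpositive gain and keeping `t` is
dominated. -/
lemma exists_good_later (hm : 1 ≤ m) (hη : 0 < η) {L : ℕ} (hL : 1 ≤ L) {G : Buffer m → ℝ} {k : ℝ}
    (hG : P.SolvesOptimality η 1 L G k) {t : Buffer m} (ht : t ≠ []) :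
    ∃ q y r, t = q ++ y :: r ∧ (0 < P.gain η y r.length ∨ r = []) ∧
      P.contValue L G t ≤ P.gain η y r.length + P.contValue L G r := by
  obtain ⟨q, y, r, rfl, hy, hq⟩ := exists_first_positive (P := P) (η := η) ht
  refine ⟨q, y, r, rfl, hy, ?_⟩
  have h1 := contValue_append_le_excess hm hη zero_le_one le_rfl hL hG (q ++ [y]) r
  rw [excess_append] at h1
  have h2 := excess_antitone (P := P) hη (show r.length + 1 ≤ [y].length + (r.length + 1) by simp) q
  have h3 : max 0 (P.gain η y (r.length + 1)) ≤ P.gain η y r.length :=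
    max_le (gain_nonneg_of_good hy) (gain_antitone hη y (by omega))
  simp only [excess, List.length_nil, zero_add, add_zero, List.append_assoc,
    List.singleton_append] at h1
  linarith

end Model

/-! ### Existence of a solution of the optimality equation -/

open scoped Classical in
/-- The allowed actions in `b`. -/
def actions (b : Buffer m) : Finset ℕ := (Finset.range (b.length + 1)).filter (Admissible b)

lemma mem_actions {b : Buffer m} {s : ℕ} : s ∈ actions b ↔ Admissible b s := by
  simp only [actions, Finset.mem_filter, Finset.mem_range, and_iff_right_iff_imp]
  exact fun h => Nat.lt_succ_of_le h.2.1

lemma length_mem_actions {b : Buffer m} (hb : b ≠ []) : b.length ∈ actions b :=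
  mem_actions.2 ⟨List.length_pos_of_ne_nil hb, le_rfl, fun h => absurd h (lt_irrefl _)⟩

lemma ne_nil_of_actions_nonempty {b : Buffer m} (h : (actions b).Nonempty) : b ≠ [] := by
  rintro rfl
  obtain ⟨s, hs⟩ := h
  obtain ⟨h1, h2, -⟩ := mem_actions.1 hs
  simp only [List.length_nil] at h2
  omega

namespace Model
variable (P : Model m)

/-- The reward of action `s` in `b` plus the discounted expectation of `G` at the next buffer. -/
def actionValue (η α : ℝ) (L : ℕ) (G : Buffer m → ℝ) (b : Buffer m) (s : ℕ) : ℝ :=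
  P.gain η (b.getD (s - 1) 0) (b.length - s) + α * P.contValue L G (b.drop s)

/-- The dynamic programming operator of the reward problem, with value `0` in the empty buffer. -/
def bellmanOp (η α : ℝ) (L : ℕ) (G : Buffer m → ℝ) (b : Buffer m) : ℝ :=
  if h : (actions b).Nonempty then (actions b).sup' h (P.actionValue η α L G b) else 0

variable {P} {η α : ℝ} {L : ℕ}

lemma actionValue_split (G : Buffer m → ℝ) (p : Buffer m) (x : Fin (m + 1)) (r : Buffer m) :
    P.actionValue η α L G (p ++ x :: r) (p.length + 1)
      = P.gain η x r.length + α * P.contValue L G r := by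
  have : p.length + (r.length + 1) - (p.length + 1) = r.length := by omega
  simp [actionValue, this]

lemma actionValue_le_bellmanOp {G : Buffer m → ℝ} {b : Buffer m} {s : ℕ} (hs : Admissible b s) :
    P.actionValue η α L G b s ≤ P.bellmanOp η α L G b := by
  have h : (actions b).Nonempty := ⟨s, mem_actions.2 hs⟩
  rw [bellmanOp, dif_pos h]
  exact Finset.le_sup' _ (mem_actions.2 hs)

lemma exists_bellmanOp_eq (G : Buffer m → ℝ) {b : Buffer m} (hb : b ≠ []) :
    ∃ s, Admissible b s ∧ P.bellmanOp η α L G b = P.actionValue η α L G b s := by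
  have h : (actions b).Nonempty := ⟨_, length_mem_actions hb⟩
  obtain ⟨s, hs, he⟩ := Finset.exists_mem_eq_sup' h (P.actionValue η α L G b)
  exact ⟨s, mem_actions.1 hs, by rw [bellmanOp, dif_pos h, he]⟩

lemma solvesOptimality_iff {G : Buffer m → ℝ} {c : ℝ} : P.SolvesOptimality η α L G c ↔
    ∀ b, IsState L b → P.bellmanOp η α L G b = G b + c := by
  constructor
  · intro hG b hb
    apply le_antisymm
    · obtain ⟨s, hs, he⟩ := exists_bellmanOp_eq (P := P) (η := η) (α := α) (L := L) G hb.1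
      obtain ⟨p, x, r, rfl, rfl, hx⟩ := admissible_iff.1 hs
      rw [he, actionValue_split]
      exact hG.le p x r hb hx
    · obtain ⟨p, x, r, rfl, hx, he⟩ := hG.attained b hb
      rw [he, ← actionValue_split]
      exact actionValue_le_bellmanOp (admissible_iff.2 ⟨p, x, r, rfl, rfl, hx⟩)
  · intro h
    refine ⟨fun p x r hb hx => ?_, fun b hb => ?_⟩
    · rw [← h _ hb, ← actionValue_split]
      exact actionValue_le_bellmanOp (admissible_iff.2 ⟨p, x, r, rfl, rfl, hx⟩)
    · obtain ⟨s, hs, he⟩ := exists_bellmanOp_eq (P := P) (η := η) (α := α) (L := L) G hb.1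
      obtain ⟨p, x, r, rfl, rfl, hx⟩ := admissible_iff.1 hs
      rw [actionValue_split] at he
      exact ⟨p, x, r, rfl, hx, by rw [← h _ hb, he]⟩

lemma contValue_mono {G H : Buffer m → ℝ} (h : ∀ b, G b ≤ H b) (r : Buffer m) :
    P.contValue L G r ≤ P.contValue L H r :=
  blockMean_mono (blockSummable_recent L G r) (blockSummable_recent L H r) fun _ _ => h _

lemma contValue_nonneg {G : Buffer m → ℝ} (h : ∀ b, 0 ≤ G b) (r : Buffer m) :
    0 ≤ P.contValue L G r := by
  have := contValue_mono (P := P) (L := L) h r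
  rwa [contValue, blockMean_const] at this

lemma contValue_le {G : Buffer m → ℝ} {C : ℝ} (h : ∀ b, G b ≤ C) (r : Buffer m) :
    P.contValue L G r ≤ C := by
  have := contValue_mono (P := P) (L := L) h r
  rwa [contValue, contValue, blockMean_const] at this

lemma bellmanOp_mono (h0 : 0 ≤ α) {G H : Buffer m → ℝ} (h : ∀ b, G b ≤ H b) (b : Buffer m) :
    P.bellmanOp η α L G b ≤ P.bellmanOp η α L H b := by
  unfold bellmanOp
  split_ifs with hb
  · exact Finset.sup'_mono_fun fun s _ =>
      add_le_add le_rfl (mul_le_mul_of_nonneg_left (contValue_mono h _) h0)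
  · exact le_rfl

lemma bellmanOp_nonneg (h0 : 0 ≤ α) {G : Buffer m → ℝ} (h : ∀ b, 0 ≤ G b) (b : Buffer m) :
    0 ≤ P.bellmanOp η α L G b := by
  rcases eq_or_ne b [] with rfl | hb
  · rw [bellmanOp, dif_neg fun h => ne_nil_of_actions_nonempty h rfl]
  · refine le_trans ?_ (actionValue_le_bellmanOp (mem_actions.1 (length_mem_actions hb)))
    rw [actionValue, Nat.sub_self]
    exact add_nonneg (gain_zero_nonneg _) (mul_nonneg h0 (contValue_nonneg h _))

lemma bellmanOp_le (hη : 0 < η) (h0 : 0 ≤ α) {G : Buffer m → ℝ} {C : ℝ} (hC : 0 ≤ C)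
    (h : ∀ b, G b ≤ C) (b : Buffer m) :
    P.bellmanOp η α L G b ≤ P.gain η (Fin.last m) 0 + α * C := by
  unfold bellmanOp
  split_ifs with hb
  · exact Finset.sup'_le hb _ fun s _ =>
      add_le_add (gain_le hη _ _) (mul_le_mul_of_nonneg_left (contValue_le h _) h0)
  · exact add_nonneg (gain_zero_nonneg _) (mul_nonneg h0 hC)

/-- The dynamic programming operator is continuous for bounded pointwise convergence, jointly with
the discount factor. -/
lemma tendsto_bellmanOp {A : ℕ → ℝ} {G : ℕ → Buffer m → ℝ} {H : Buffer m → ℝ} {C : ℝ}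
    (hC : ∀ n b, |G n b| ≤ C) (hA : Tendsto A atTop (𝓝 α))
    (hG : ∀ b, Tendsto (fun n => G n b) atTop (𝓝 (H b))) (b : Buffer m) :
    Tendsto (fun n => P.bellmanOp η (A n) L (G n) b) atTop (𝓝 (P.bellmanOp η α L H b)) := by
  unfold bellmanOp
  split_ifs with hb
  · refine Tendsto.finset_sup'_nhds_apply hb fun s _ => ?_
    refine tendsto_const_nhds.add (hA.mul ?_)
    refine tendsto_tsum_of_dominated_convergence
      (bound := fun β => P.blockProb β * C) (P.hasSum_blockProb.summable.mul_right C)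
      (fun β => (hG _).const_mul _) (Eventually.of_forall fun n β => ?_)
    rw [Real.norm_eq_abs, abs_mul, abs_of_nonneg (P.blockProb_nonneg β)]
    exact mul_le_mul_of_nonneg_left (hC _ _) (P.blockProb_nonneg β)
  · exact tendsto_const_nhds

/-- The discounted problem has a solution: the limit of value iteration from `0`. -/
lemma exists_discounted (hη : 0 < η) (h0 : 0 ≤ α) (h1 : α < 1) (P : Model m) (L : ℕ) :
    ∃ G : Buffer m → ℝ, P.SolvesOptimality η α L G 0 ∧
      ∀ b, 0 ≤ G b ∧ G b ≤ P.gain η (Fin.last m) 0 / (1 - α) := by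
  set R := P.gain η (Fin.last m) 0 with hR
  have hR0 : 0 ≤ R := gain_zero_nonneg _
  have h1' : 0 < 1 - α := by linarith
  let V : ℕ → Buffer m → ℝ := fun n => (P.bellmanOp η α L)^[n] fun _ => 0
  have hV : ∀ n, V (n + 1) = P.bellmanOp η α L (V n) := fun n => Function.iterate_succ_apply' _ _ _
  have hV0 : ∀ n b, 0 ≤ V n b := by
    intro n
    induction n with
    | zero => exact fun b => le_rfl
    | succ n ih => rw [hV]; exact bellmanOp_nonneg h0 ih
  have hV1 : ∀ n b, V n b ≤ R / (1 - α) := by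
    intro n
    induction n with
    | zero => exact fun b => by positivity
    | succ n ih =>
      intro b
      rw [hV]
      refine (bellmanOp_le hη h0 (by positivity) ih b).trans (le_of_eq ?_)
      rw [← hR]
      field_simp
      ring
  have hmono : ∀ n b, V n b ≤ V (n + 1) b := by
    intro n
    induction n with
    | zero => exact hV0 1
    | succ n ih =>
      intro b
      rw [hV (n + 1)]
      conv_lhs => rw [hV n]
      exact bellmanOp_mono h0 ih b
  have hlim : ∀ b, Tendsto (fun n => V n b) atTop (𝓝 (⨆ n, V n b)) := fun b =>
    tendsto_atTop_ciSup (monotone_nat_of_le_succ fun n => hmono n b)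
      ⟨R / (1 - α), by rintro _ ⟨n, rfl⟩; exact hV1 n b⟩
  refine ⟨fun b => ⨆ n, V n b, solvesOptimality_iff.2 fun b _ => ?_, fun b =>
    ⟨ge_of_tendsto' (hlim b) fun n => hV0 n b, le_of_tendsto' (hlim b) fun n => hV1 n b⟩⟩
  have hT := tendsto_bellmanOp (P := P) (η := η) (L := L) (A := fun _ => α) (C := R / (1 - α))
    (fun n b => by rw [abs_of_nonneg (hV0 n b)]; exact hV1 n b) tendsto_const_nhds hlim b
  have h2 : Tendsto (fun n => V (n + 1) b) atTop (𝓝 (P.bellmanOp η α L (fun b => ⨆ n, V n b) b)) :=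
    hT.congr fun n => by rw [hV]
  rw [add_zero]
  exact tendsto_nhds_unique h2 ((hlim b).comp (tendsto_add_atTop_nat 1))

/-- Relative values of the discounted problem, which are bounded uniformly in the discount factor:
sending the freshest packet resets the buffer, and the content of a buffer is worth at most its
excess. -/
lemma exists_relative_discounted (hm : 1 ≤ m) (hη : 0 < η) (h0 : 0 ≤ α) (h1 : α < 1)
    (P : Model m) (hL : 1 ≤ L) :
    ∃ (H : Buffer m → ℝ) (c : ℝ), P.SolvesOptimality η α L H c ∧
      (∀ b, |H b| ≤ P.gain η (Fin.last m) 0 * (1 + L)) ∧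
      0 ≤ c ∧ c ≤ P.gain η (Fin.last m) 0 := by
  classical
  obtain ⟨G, hG, hb⟩ := exists_discounted hη h0 h1 P L
  set R := P.gain η (Fin.last m) 0 with hR
  have hR0 : 0 ≤ R := gain_zero_nonneg _
  set f := P.contValue L G [] with hf
  have hf0 : 0 ≤ f := contValue_nonneg (fun b => (hb b).1) _
  have hf1 : f * (1 - α) ≤ R := by
    rw [← le_div_iff₀ (by linarith)]
    exact contValue_le (fun b => (hb b).2) _
  let H : Buffer m → ℝ := fun b => if IsState L b then G b - α * f else 0
  have hH : ∀ b, IsState L b → H b = G b - α * f := fun b h => if_pos h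
  have hcont : ∀ r, P.contValue L H r = P.contValue L G r - α * f := by
    intro r
    have := blockMean_sub (blockSummable_recent (P := P) L G r) (.const (α * f))
    rw [blockMean_const] at this
    rw [contValue, contValue, ← this]
    exact blockMean_congr fun β hβ => hH _ (isState_recent hL (by simp [hβ]))
  refine ⟨H, α * f * (1 - α), ⟨fun p x r hs hx => ?_, fun b hs => ?_⟩, fun b => ?_, ?_, ?_⟩
  · have := hG.le p x r hs hx
    rw [hcont, hH _ hs]
    linarith
  · obtain ⟨p, x, r, he, hx, hval⟩ := hG.attained b hs
    refine ⟨p, x, r, he, hx, ?_⟩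
    rw [hcont, hH _ hs]
    linarith
  · by_cases hs : IsState L b
    · rw [hH b hs, abs_of_nonneg]
      · obtain ⟨p, x, r, rfl, hx, hval⟩ := hG.attained b hs
        have h2 := contValue_append_le_excess hm hη h0 h1.le hL hG r []
        have h3 := excess_le (P := P) hη (([] : Buffer m).length + 1) r
        rw [List.append_nil] at h2
        have h4 := gain_le (P := P) hη x r.length
        have h5 : (r.length : ℝ) ≤ L := by
          have := hs.2
          simp only [List.length_append, List.length_cons] at this
          exact_mod_cast (by omega : r.length ≤ L)
        have h6 := mul_le_mul_of_nonneg_left h5 hR0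
        have h7 := mul_le_mul_of_nonneg_left h2 h0
        have h8 : α * P.excess η (([] : Buffer m).length + 1) r
            ≤ P.excess η (([] : Buffer m).length + 1) r :=
          mul_le_of_le_one_left (excess_nonneg _ _) h1.le
        rw [mul_add] at h7
        rw [← hR] at h3 h4
        linarith
      · obtain ⟨q, y, rfl⟩ : ∃ q y, b = q ++ [y] :=
          ⟨_, _, (List.dropLast_append_getLast hs.1).symm⟩
        have h2 := hG.le q y [] hs (by simp)
        have h3 := gain_zero_nonneg (P := P) (η := η) y
        simp only [List.length_nil] at h2
        linarith
    · simp only [H, if_neg hs, abs_zero]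
      positivity
  · have : 0 ≤ 1 - α := by linarith
    positivity
  · nlinarith

/-- The optimality equation of the average-reward problem has a solution. It is a limit point of the
relative values of the discounted problems, as the discount factor tends to `1`. -/
theorem exists_solvesOptimality (hm : 1 ≤ m) (hη : 0 < η) (P : Model m) (hL : 1 ≤ L) :
    ∃ (G : Buffer m → ℝ) (c : ℝ), P.SolvesOptimality η 1 L G c := by
  have hA0 : ∀ n : ℕ, (0 : ℝ) ≤ 1 - 1 / ((n : ℝ) + 1) := fun n => by
    rw [sub_nonneg, div_le_one (by positivity)]
    linarith [(Nat.cast_nonneg n : (0 : ℝ) ≤ n)]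
  have hA1 : ∀ n : ℕ, 1 - 1 / ((n : ℝ) + 1) < 1 := fun n => by
    have : 0 < 1 / ((n : ℝ) + 1) := by positivity
    linarith
  choose H c hH hb hc0 hc1 using fun n : ℕ =>
    exists_relative_discounted (η := η) hm hη (hA0 n) (hA1 n) P hL
  set R := P.gain η (Fin.last m) 0
  have hcomp : IsCompact ((Set.univ.pi fun _ : Buffer m => Set.Icc (-(R * (1 + L))) (R * (1 + L)))
      ×ˢ Set.Icc 0 R) :=
    (isCompact_univ_pi fun _ => isCompact_Icc).prod isCompact_Icc
  obtain ⟨⟨G, k⟩, -, φ, hφ, hlim⟩ := hcomp.tendsto_subseq (x := fun n => (H n, c n)) fun n =>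
    ⟨fun b _ => abs_le.1 (hb n b), hc0 n, hc1 n⟩
  rw [nhds_prod_eq, tendsto_prod_iff'] at hlim
  have hlimG := tendsto_pi_nhds.1 hlim.1
  refine ⟨G, k, solvesOptimality_iff.2 fun b hs => ?_⟩
  have hA : Tendsto (fun n : ℕ => 1 - 1 / ((φ n : ℝ) + 1)) atTop (𝓝 1) := by
    have := (tendsto_one_div_add_atTop_nhds_zero_nat (𝕜 := ℝ)).comp hφ.tendsto_atTop
    simpa using this.const_sub 1
  refine tendsto_nhds_unique
    (tendsto_bellmanOp (fun n b => hb (φ n) b) hA hlimG b) ?_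
  refine ((hlimG b).add hlim.2).congr fun n => ?_
  exact (solvesOptimality_iff.1 (hH (φ n)) b hs).symm

end Model

/-! ### Costs and rewards -/

namespace Model
variable {P : Model m} {η : ℝ}

lemma blockSummable_importance (P : Model m) :
    P.BlockSummable fun β => 1 / P.mu * P.importance β := by
  have hmu := P.mu_pos
  refine .of_le 0 (1 / P.mu * P.v (Fin.last m)) fun β _ => ?_
  rw [abs_of_nonneg (mul_nonneg (by positivity) (P.importance_nonneg β)), zero_add, mul_assoc]
  exact mul_le_mul_of_nonneg_left (P.importance_le β) (by positivity)

/-- Passage from costs to rewards: paying for the lost packets is the same as paying for all packets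
and being refunded for the sent ones. -/
lemma bellmanRHS_split (M : ℕ) (h G : Buffer m → ℝ)
    (hG : ∀ b, G b = 1 / P.mu * P.importance b - h b) (p : Buffer m) (x : Fin (m + 1))
    (r : Buffer m) :
    P.bellmanRHS M η h (p ++ x :: r) (p.length + 1) =
      1 / P.mu * P.importance (p ++ x :: r)
        + (P.blockMean (fun β => 1 / P.mu * P.importance β) - 1 / P.mu * P.v 0)
        - (P.gain η x r.length + 1 * P.contValue M G r) := by
  have h1 : (p ++ x :: r).take (p.length + 1 - 1) = p := by simp
  have h2 : (p ++ x :: r).drop (p.length + 1) = r := by simp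
  have h3 : P.importance (p ++ x :: r) = P.importance p + (P.v x + P.importance r) := by
    rw [importance_append]
    simp [importance]
  have h4 : (fun β => 1 / P.mu * P.importance (forgotten M (r ++ β)) + h (recent M (r ++ β)))
      = fun β => (1 / P.mu * P.importance r + 1 / P.mu * P.importance β)
          - G (recent M (r ++ β)) := by
    funext β
    have := P.importance_forgotten_add M (r ++ β)
    rw [importance_append] at this
    rw [hG, ← mul_add, ← this]
    ring
  rw [bellmanRHS, stageCost, h1, h2, h4,
    blockMean_sub (.add (.const _) (blockSummable_importance P)) (blockSummable_recent M G r),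
    blockMean_add (.const _) (blockSummable_importance P), blockMean_const, h3, contValue, gain]
  simp only [List.length_append, List.length_cons]
  push_cast
  ring

/-- A stationary policy solves the Bellman equation if and only if it attains the maximum in the
optimality equation of the reward problem, for some solution of the latter. -/
lemma bellmanOptimal_iff {M : ℕ} {s : Buffer m → ℕ} :
    P.BellmanOptimal M η s ↔ ∃ (G : Buffer m → ℝ) (c : ℝ), P.SolvesOptimality η 1 M G c ∧
      ∀ b, IsState M b → ∃ p x r, b = p ++ x :: r ∧ s b = p.length + 1 ∧ (r ≠ [] → x ≠ 0) ∧
        G b + c = P.gain η x r.length + 1 * P.contValue M G r := by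
  set κ := P.blockMean (fun β => 1 / P.mu * P.importance β) - 1 / P.mu * P.v 0 with hκ
  constructor
  · rintro ⟨ρ, h, H⟩
    let G : Buffer m → ℝ := fun b => 1 / P.mu * P.importance b - h b
    have hR := bellmanRHS_split (P := P) (η := η) M h G (fun _ => rfl)
    have key : ∀ b, IsState M b → ∃ p x r, b = p ++ x :: r ∧ s b = p.length + 1 ∧
        (r ≠ [] → x ≠ 0) ∧
        G b + (κ - ρ) = P.gain η x r.length + 1 * P.contValue M G r := by
      intro b hb
      obtain ⟨hadm, heq, -⟩ := H b hb
      obtain ⟨p, x, r, rfl, hs, hx⟩ := admissible_iff.1 hadm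
      refine ⟨p, x, r, rfl, hs, hx, ?_⟩
      rw [hs, hR] at heq
      simp only [G]
      linarith
    refine ⟨G, κ - ρ, ⟨fun p x r hb hx => ?_, fun b hb => ?_⟩, key⟩
    · obtain ⟨-, heq, hmin⟩ := H _ hb
      have := hmin _ (admissible_iff.2 ⟨p, x, r, rfl, rfl, hx⟩)
      rw [← heq, hR] at this
      simp only [G] at this ⊢
      linarith
    · obtain ⟨p, x, r, h1, -, h2, h3⟩ := key b hb
      exact ⟨p, x, r, h1, h2, h3⟩
  · rintro ⟨G, c, hG, key⟩
    let h : Buffer m → ℝ := fun b => 1 / P.mu * P.importance b - G b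
    have hR := bellmanRHS_split (P := P) (η := η) M h G (fun _ => by simp only [h]; ring)
    refine ⟨κ - c, h, fun b hb => ?_⟩
    obtain ⟨p, x, r, rfl, hs, hx, heq⟩ := key b hb
    rw [hs]
    refine ⟨admissible_iff.2 ⟨p, x, r, rfl, rfl, hx⟩, ?_, fun a ha => ?_⟩
    · rw [hR]
      simp only [h]
      linarith
    · obtain ⟨p', x', r', he, rfl, hx'⟩ := admissible_iff.1 ha
      rw [hR]
      rw [he] at hb heq ⊢
      rw [hR]
      have := hG.le p' x' r' hb hx'
      linarith

/-! ### The Bellman equation implies average optimality -/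

lemma abs_blockMean_le {f g : Buffer m → ℝ} (hf : P.BlockSummable f) (hg : P.BlockSummable g)
    (h : ∀ β, β ≠ [] → |f β| ≤ g β) : |P.blockMean f| ≤ P.blockMean g := by
  refine abs_le.2 ⟨?_, blockMean_mono hf hg fun β hβ => (abs_le.1 (h β hβ)).2⟩
  have hg' : P.BlockSummable fun β => 0 - g β := .sub (.const 0) hg
  have := blockMean_mono hg' hf fun β hβ => by linarith [(abs_le.1 (h β hβ)).1]
  rw [blockMean_sub (.const 0) hg, blockMean_const] at this
  linarith

lemma blockSummable_linear (a b : ℝ) : P.BlockSummable fun β => a + b * β.length :=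
  .of_le |a| |b| fun β _ => (abs_add_le _ _).trans (by rw [abs_mul, Nat.abs_cast])

lemma abs_forgottenCost_le {M : ℕ} {r : Buffer m} (hr : r.length ≤ M) (β : Buffer m) :
    |1 / P.mu * P.importance (forgotten M (r ++ β))|
      ≤ 1 / P.mu * P.v (Fin.last m) * M + 1 / P.mu * P.v (Fin.last m) * β.length := by
  have hmu := P.mu_pos
  rw [abs_of_nonneg (mul_nonneg (by positivity) (P.importance_nonneg _))]
  have h1 := P.importance_le (r ++ β)
  have h2 := P.importance_forgotten_add M (r ++ β)
  have h3 := P.importance_nonneg (recent M (r ++ β))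
  have h4 : ((r ++ β).length : ℝ) ≤ M + β.length := by
    rw [List.length_append]
    exact_mod_cast Nat.add_le_add_right hr _
  have h5 := mul_le_mul_of_nonneg_left h4 (P.v_nonneg (Fin.last m))
  calc _ ≤ 1 / P.mu * (P.v (Fin.last m) * (M + β.length)) :=
        mul_le_mul_of_nonneg_left (by linarith) (by positivity)
    _ = _ := by ring

lemma abs_stageCost_le (hη : 0 < η) {M : ℕ} {b : Buffer m} (hb : b.length ≤ M) {s : ℕ}
    (hs : Admissible b s) : |P.stageCost η b s| ≤ 1 / P.mu * P.v (Fin.last m) * M + η * M := by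
  have hmu := P.mu_pos
  have hv := P.v_nonneg (Fin.last m)
  have h1 : (s : ℝ) ≤ b.length := by exact_mod_cast hs.2.1
  have h2 : (b.length : ℝ) ≤ M := by exact_mod_cast hb
  have h3 : (0 : ℝ) ≤ s := by positivity
  have h4 := P.importance_nonneg (b.take (s - 1))
  have h5 : P.importance (b.take (s - 1)) ≤ P.v (Fin.last m) * M := by
    refine (P.importance_le _).trans (mul_le_mul_of_nonneg_left ?_ hv)
    have : (b.take (s - 1)).length ≤ M := by rw [List.length_take]; omega
    exact_mod_cast this
  rw [stageCost, abs_of_nonneg (add_nonneg (by positivity) (mul_nonneg hη.le (by linarith))),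
    mul_assoc]
  exact add_le_add (mul_le_mul_of_nonneg_left h5 (by positivity))
    (mul_le_mul_of_nonneg_left (by linarith) hη.le)

/-- If the expected cost of `N` selections is bounded, uniformly in the history and the buffer, then
the function of the next block whose mean is the expected cost of `N + 1` selections has linear
growth. -/
lemma abs_expCost_integrand_le (hη : 0 < η) {M : ℕ} (hM : 1 ≤ M) {π : Policy m}
    (hπ : IsPolicy M π) {N : ℕ} {B : ℝ}
    (hB : ∀ hist r, r.length ≤ M → |P.expCost M η π N hist r| ≤ B)
    (hist : List (Buffer m)) {r : Buffer m} (hr : r.length ≤ M) {β : Buffer m} (hβ : β ≠ []) :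
    |1 / P.mu * P.importance (forgotten M (r ++ β)) +
      P.stageCost η (recent M (r ++ β)) (π (β :: hist) (recent M (r ++ β))) +
      P.expCost M η π N (β :: hist)
        ((recent M (r ++ β)).drop (π (β :: hist) (recent M (r ++ β))))|
    ≤ 1 / P.mu * P.v (Fin.last m) * M + (1 / P.mu * P.v (Fin.last m) * M + η * M) + B
      + 1 / P.mu * P.v (Fin.last m) * β.length := by
  have hst : IsState M (recent M (r ++ β)) := isState_recent hM (by simp [hβ])
  have h1 := abs_forgottenCost_le (P := P) hr β
  have h2 := abs_stageCost_le (P := P) hη hst.2 (hπ (β :: hist) _ hst)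
  have h3 := hB (β :: hist) ((recent M (r ++ β)).drop (π (β :: hist) (recent M (r ++ β))))
    (by rw [List.length_drop]; exact (Nat.sub_le _ _).trans hst.2)
  refine (abs_add_three _ _ _).trans ?_
  linarith

lemma exists_expCost_bound (hη : 0 < η) {M : ℕ} (hM : 1 ≤ M) {π : Policy m} (hπ : IsPolicy M π)
    (N : ℕ) : ∃ B, ∀ hist r, r.length ≤ M → |P.expCost M η π N hist r| ≤ B := by
  induction N with
  | zero => exact ⟨0, fun _ _ _ => by simp [expCost]⟩
  | succ N ih =>
    obtain ⟨B, hB⟩ := ih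
    exact ⟨_, fun hist r hr => abs_blockMean_le
      (.of_le _ _ fun β hβ => abs_expCost_integrand_le hη hM hπ hB hist hr hβ)
      (blockSummable_linear _ _)
      fun β hβ => abs_expCost_integrand_le hη hM hπ hB hist hr hβ⟩

lemma blockSummable_expCost (hη : 0 < η) {M : ℕ} (hM : 1 ≤ M) {π : Policy m} (hπ : IsPolicy M π)
    (N : ℕ) (hist : List (Buffer m)) {r : Buffer m} (hr : r.length ≤ M) :
    P.BlockSummable fun β => 1 / P.mu * P.importance (forgotten M (r ++ β)) +
      P.stageCost η (recent M (r ++ β)) (π (β :: hist) (recent M (r ++ β))) +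
      P.expCost M η π N (β :: hist)
        ((recent M (r ++ β)).drop (π (β :: hist) (recent M (r ++ β)))) := by
  obtain ⟨B, hB⟩ := exists_expCost_bound (P := P) hη hM hπ N
  exact .of_le _ _ fun β hβ => abs_expCost_integrand_le hη hM hπ hB hist hr hβ

/-- The expected cost until and including the relative value at the next speaking time. -/
def preValue (P : Model m) (M : ℕ) (h : Buffer m → ℝ) (r : Buffer m) : ℝ :=
  P.blockMean fun β =>
    1 / P.mu * P.importance (forgotten M (r ++ β)) + h (recent M (r ++ β))

lemma blockSummable_preValue {M : ℕ} (h : Buffer m → ℝ) {r : Buffer m} (hr : r.length ≤ M) :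
    P.BlockSummable fun β =>
      1 / P.mu * P.importance (forgotten M (r ++ β)) + h (recent M (r ++ β)) :=
  .add (.of_le _ _ fun β _ => abs_forgottenCost_le hr β) (blockSummable_recent M h r)

/-- If the relative values `h` and the average cost `ρ` satisfy the Bellman inequality, then
`N` selections of any policy cost at least `N * ρ`, up to a constant. -/
lemma le_expCost (hη : 0 < η) {M : ℕ} (hM : 1 ≤ M) {ρ : ℝ} {h : Buffer m → ℝ}
    (hB : ∀ b, IsState M b → ∀ a, Admissible b a → h b + ρ ≤ P.bellmanRHS M η h b a)
    {C : ℝ} (hC : ∀ r : Buffer m, r.length ≤ M → |P.preValue M h r| ≤ C)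
    {π : Policy m} (hπ : IsPolicy M π) (N : ℕ) (hist : List (Buffer m)) (r : Buffer m)
    (hr : r.length ≤ M) : P.preValue M h r + (N * ρ - C) ≤ P.expCost M η π N hist r := by
  induction N generalizing hist r with
  | zero =>
    have := (abs_le.1 (hC r hr)).2
    simp only [expCost, Nat.cast_zero, zero_mul]
    linarith
  | succ N ih =>
    have := blockMean_mono
      (.add (blockSummable_preValue (P := P) h hr) (.const (((N + 1 : ℕ) : ℝ) * ρ - C)))
      (blockSummable_expCost hη hM hπ N hist hr) fun β hβ => by
        have hst : IsState M (recent M (r ++ β)) := isState_recent hM (by simp [hβ])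
        have h1 := ih (β :: hist) ((recent M (r ++ β)).drop (π (β :: hist) (recent M (r ++ β))))
          (by rw [List.length_drop]; exact (Nat.sub_le _ _).trans hst.2)
        have h2 := hB _ hst _ (hπ (β :: hist) _ hst)
        rw [bellmanRHS, ← preValue] at h2
        push_cast
        linarith
    rwa [blockMean_add (blockSummable_preValue h hr) (.const _), blockMean_const] at this

/-- A stationary policy that satisfies the evaluation equations with relative values `h` and average
cost `ρ` pays at most `N * ρ` for `N` selections, up to a constant. -/
lemma expCost_le (hη : 0 < η) {M : ℕ} (hM : 1 ≤ M) {ρ : ℝ} {h : Buffer m → ℝ}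
    {s : Buffer m → ℕ} (hs : IsPolicy M fun _ b => s b)
    (hB : ∀ b, IsState M b → h b + ρ = P.bellmanRHS M η h b (s b))
    {C : ℝ} (hC : ∀ r : Buffer m, r.length ≤ M → |P.preValue M h r| ≤ C)
    (N : ℕ) (hist : List (Buffer m)) (r : Buffer m) (hr : r.length ≤ M) :
    P.expCost M η (fun _ b => s b) N hist r ≤ P.preValue M h r + (N * ρ + C) := by
  induction N generalizing hist r with
  | zero =>
    have := (abs_le.1 (hC r hr)).1
    simp only [expCost, Nat.cast_zero, zero_mul]
    linarith
  | succ N ih =>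
    have := blockMean_mono (blockSummable_expCost hη hM hs N hist hr)
      (.add (blockSummable_preValue (P := P) h hr) (.const (((N + 1 : ℕ) : ℝ) * ρ + C)))
      fun β hβ => by
        have hst : IsState M (recent M (r ++ β)) := isState_recent hM (by simp [hβ])
        have h1 := ih (β :: hist) ((recent M (r ++ β)).drop (s (recent M (r ++ β))))
          (by rw [List.length_drop]; exact (Nat.sub_le _ _).trans hst.2)
        have h2 := hB _ hst
        rw [bellmanRHS, ← preValue] at h2
        push_cast
        linarith
    rwa [blockMean_add (blockSummable_preValue h hr) (.const _), blockMean_const] at this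

lemma tendsto_coe_add_div (ρ C : ℝ) :
    Tendsto (fun N : ℕ => ((ρ + C / (N : ℝ) : ℝ) : EReal)) atTop (𝓝 (ρ : EReal)) := by
  refine (continuous_coe_real_ereal.tendsto ρ).comp ?_
  simpa using (tendsto_const_div_atTop_nhds_zero_nat C).const_add ρ

/-- Verification theorem: a stationary policy that solves the Bellman equation has the smallest
long-run average cost. -/
theorem BellmanOptimal.averageOptimal (hη : 0 < η) {M : ℕ} (hM : 1 ≤ M) {s : Buffer m → ℕ}
    (hs : P.BellmanOptimal M η s) : P.AverageOptimal M η s := by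
  obtain ⟨ρ, h, H⟩ := hs
  have hpol : IsPolicy M fun _ b => s b := fun _ b hb => (H b hb).1
  refine ⟨hpol, fun r hr π hπ => ?_⟩
  obtain ⟨C, hC⟩ := exists_bound M (P.preValue M h)
  have hr' := abs_le.1 (hC r hr)
  refine le_trans (b := (ρ : EReal)) ?_ ?_
  · rw [avgCost, ← (tendsto_coe_add_div ρ (2 * C)).limsup_eq]
    refine limsup_le_limsup ?_
    filter_upwards [eventually_gt_atTop 0] with N hN
    have hN' : (0 : ℝ) < N := by exact_mod_cast hN
    have := expCost_le hη hM hpol (fun b hb => (H b hb).2.1) hC N [] r hr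
    rw [EReal.coe_le_coe_iff, div_le_iff₀ hN', add_mul, div_mul_cancel₀ _ hN'.ne']
    linarith [hr'.2]
  · rw [avgCost, ← (tendsto_coe_add_div ρ (-(2 * C))).limsup_eq]
    refine limsup_le_limsup ?_
    filter_upwards [eventually_gt_atTop 0] with N hN
    have hN' : (0 : ℝ) < N := by exact_mod_cast hN
    have := le_expCost hη hM
      (fun b hb a ha => (H b hb).2.1.le.trans ((H b hb).2.2 a ha)) hC hπ N [] r hr
    rw [EReal.coe_le_coe_iff, le_div_iff₀ hN', add_mul, div_mul_cancel₀ _ hN'.ne']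
    linarith [hr'.1]

/-! ### Buffers of size `K(η)` suffice -/

lemma lt_bufBound_of_gain_pos (hη : 0 < η) {x : Fin (m + 1)} {a : ℕ} (h : 0 < P.gain η x a) :
    a < P.bufBound η x := by
  rw [bufBound, Nat.lt_ceil, ← mul_div_assoc, lt_div_iff₀ hη]
  simp only [gain] at h
  linarith

lemma bufBound_le_bufSize (hη : 0 < η) (x : Fin (m + 1)) : P.bufBound η x ≤ P.bufSize η := by
  have hmu := P.mu_pos
  have := P.v_strictMono.monotone (Fin.le_last x)
  unfold bufBound bufSize
  gcongr

lemma one_le_bufSize (hm : 1 ≤ m) (hη : 0 < η) : 1 ≤ P.bufSize η :=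
  lt_bufBound_of_gain_pos (x := Fin.last m) hη
    (gain_zero_pos (by rw [Ne, Fin.ext_iff]; simp; omega))

/-- The packets sent with positive gain, and the freshest packet, are among the `K(η)` most recent
ones. -/
lemma length_lt_bufSize (hm : 1 ≤ m) (hη : 0 < η) {x : Fin (m + 1)} {r : Buffer m}
    (h : 0 < P.gain η x r.length ∨ r = []) : r.length < P.bufSize η := by
  rcases h with h | rfl
  · exact (lt_bufBound_of_gain_pos hη h).trans_le (bufBound_le_bufSize hη x)
  · exact one_le_bufSize hm hη

/-- In every state some optimal action sends a packet of positive gain or the freshest one. -/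
lemma exists_good_action (hm : 1 ≤ m) (hη : 0 < η) {L : ℕ} (hL : 1 ≤ L) {G : Buffer m → ℝ} {c : ℝ}
    (hG : P.SolvesOptimality η 1 L G c) {b : Buffer m} (hb : IsState L b) :
    ∃ p x r, b = p ++ x :: r ∧ (0 < P.gain η x r.length ∨ r = []) ∧
      G b + c = P.gain η x r.length + 1 * P.contValue L G r := by
  obtain ⟨p, x, r, rfl, hx, heq⟩ := hG.attained b hb
  by_cases hgood : 0 < P.gain η x r.length ∨ r = []
  · exact ⟨p, x, r, rfl, hgood, heq⟩
  · push Not at hgood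
    obtain ⟨q, y, t, rfl, hy, hle⟩ := exists_good_later hm hη hL hG hgood.2
    have hsplit : p ++ x :: (q ++ y :: t) = (p ++ x :: q) ++ y :: t := by simp
    refine ⟨p ++ x :: q, y, t, hsplit, hy, le_antisymm ?_ ?_⟩
    · linarith [hgood.1]
    · rw [hsplit] at hb ⊢
      exact hG.le _ y t hb (ne_zero_of_good hη hy)

/-- A solution at level `K(η)` extends to a solution at every larger level, by ignoring all but the
`K(η)` most recent packets. -/
lemma SolvesOptimality.extend (hm : 1 ≤ m) (hη : 0 < η) {M : ℕ} (hM : P.bufSize η ≤ M)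
    {G : Buffer m → ℝ} {c : ℝ} (hG : P.SolvesOptimality η 1 (P.bufSize η) G c) :
    P.SolvesOptimality η 1 M (fun b => G (recent (P.bufSize η) b)) c := by
  have hK := one_le_bufSize (P := P) hm hη
  have hcont : ∀ r, P.contValue M (fun b => G (recent (P.bufSize η) b)) r
      = P.contValue (P.bufSize η) G r := fun r => by
    simp only [contValue, recent_recent hM]
  have hgood : ∀ p x r, (0 < P.gain η x r.length ∨ r = []) →
      P.gain η x r.length + 1 * P.contValue (P.bufSize η) G r
        ≤ G (recent (P.bufSize η) (p ++ x :: r)) + c := by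
    intro p x r h
    obtain ⟨p', hp'⟩ := recent_append_of_length_le p (x :: r) (length_lt_bufSize hm hη h)
    have hst : IsState (P.bufSize η) (recent (P.bufSize η) (p ++ x :: r)) :=
      isState_recent hK (by simp)
    rw [hp'] at hst ⊢
    exact hG.le p' x r hst (ne_zero_of_good hη h)
  refine ⟨fun p x r hb hx => ?_, fun b hb => ?_⟩
  · rw [hcont]
    by_cases h : 0 < P.gain η x r.length ∨ r = []
    · exact hgood p x r h
    · push Not at h
      obtain ⟨q, y, t, rfl, hy, hle⟩ := exists_good_later hm hη hK hG h.2
      have h2 := hgood (p ++ x :: q) y t hy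
      rw [show p ++ x :: (q ++ y :: t) = (p ++ x :: q) ++ y :: t by simp]
      linarith [h.1]
  · obtain ⟨p, x, r, he, hx, heq⟩ := hG.attained _ (isState_recent hK hb.1)
    refine ⟨forgotten (P.bufSize η) b ++ p, x, r, ?_, hx, ?_⟩
    · rw [List.append_assoc, ← he, forgotten_append_recent]
    · rw [hcont, heq]

end Model

end AgeDistortion

end

open AgeDistortion in
theorem theorem3 {m : ℕ} (hm : 1 ≤ m) (P : Model m) (η : ℝ) (hη : 0 < η)
    (M : ℕ) (hM : P.bufSize η ≤ M) :
    (∃ σ : Buffer m → ℕ,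
      (∀ b, IsState (P.bufSize η) b → Admissible b (σ b)) ∧
      P.BellmanOptimal M η (extend (P.bufSize η) σ) ∧
      P.AverageOptimal M η (extend (P.bufSize η) σ) ∧
      ∀ b, IsState M b → ∀ i : Fin (m + 1), i ≠ 0 →
        b[extend (P.bufSize η) σ b - 1]? = some i →
        b.length < extend (P.bufSize η) σ b + P.bufBound η i) ∧
    (∀ s : Buffer m → ℕ, P.BellmanOptimal M η s →
      ∀ b, IsState M b → ∀ i : Fin (m + 1), b[s b - 1]? = some i →
        (b.length : ℝ) - (s b : ℝ) ≤ 1 / P.mu * ((P.v i - P.v 0) / η)) := by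
  have hK := Model.one_le_bufSize (P := P) hm hη
  have hM1 : 1 ≤ M := hK.trans hM
  constructor
  · obtain ⟨G, c, hG⟩ := Model.exists_solvesOptimality hm hη P hK
    have hex : ∀ b, ∃ s, IsState (P.bufSize η) b → ∃ p x r, b = p ++ x :: r ∧
        s = p.length + 1 ∧ (0 < P.gain η x r.length ∨ r = []) ∧
        G b + c = P.gain η x r.length + 1 * P.contValue (P.bufSize η) G r := by
      intro b
      by_cases hb : IsState (P.bufSize η) b
      · obtain ⟨p, x, r, h1, h2, h3⟩ := Model.exists_good_action hm hη hK hG hb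
        exact ⟨p.length + 1, fun _ => ⟨p, x, r, h1, rfl, h2, h3⟩⟩
      · exact ⟨0, fun h => absurd h hb⟩
    choose σ hσ using hex
    have hext : ∀ b, IsState M b → ∃ p x r, b = p ++ x :: r ∧
        extend (P.bufSize η) σ b = p.length + 1 ∧ (0 < P.gain η x r.length ∨ r = []) ∧
        G (recent (P.bufSize η) b) + c
          = P.gain η x r.length + 1 * P.contValue (P.bufSize η) G r := by
      intro b hb
      obtain ⟨p, x, r, h1, h2, h3, h4⟩ := hσ _ (isState_recent hK hb.1)
      refine ⟨forgotten (P.bufSize η) b ++ p, x, r, ?_, ?_, h3, h4⟩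
      · rw [List.append_assoc, ← h1, forgotten_append_recent]
      · rw [extend, h2, List.length_append, forgotten, List.length_take]
        omega
    have hbell : P.BellmanOptimal M η (extend (P.bufSize η) σ) := by
      refine Model.bellmanOptimal_iff.2 ⟨_, c, hG.extend hm hη hM, fun b hb => ?_⟩
      obtain ⟨p, x, r, h1, h2, h3, h4⟩ := hext b hb
      refine ⟨p, x, r, h1, h2, Model.ne_zero_of_good hη h3, ?_⟩
      simp only [Model.contValue, recent_recent hM]
      exact h4
    refine ⟨σ, fun b hb => ?_, hbell, hbell.averageOptimal hη hM1, fun b hb i hi hbi => ?_⟩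
    · obtain ⟨p, x, r, h1, h2, h3, -⟩ := hσ b hb
      exact admissible_iff.2 ⟨p, x, r, h1, h2, Model.ne_zero_of_good hη h3⟩
    · obtain ⟨p, x, r, rfl, h2, h3, -⟩ := hext b hb
      rw [h2] at hbi ⊢
      obtain rfl : x = i := by simpa using hbi
      have hpos : 0 < P.gain η x r.length := by
        rcases h3 with h3 | rfl
        · exact h3
        · exact Model.gain_zero_pos hi
      have := Model.lt_bufBound_of_gain_pos hη hpos
      simp only [List.length_append, List.length_cons]
      omega
  · intro s hs b hb i hbi
    obtain ⟨G, c, hG, key⟩ := Model.bellmanOptimal_iff.1 hs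
    obtain ⟨p, x, r, rfl, h2, hx, heq⟩ := key b hb
    rw [h2] at hbi ⊢
    obtain rfl : x = i := by simpa using hbi
    by_contra! hlt
    have hlen : ((p ++ x :: r).length : ℝ) - ((p.length + 1 : ℕ) : ℝ) = r.length := by
      simp only [List.length_append, List.length_cons]
      push_cast
      ring
    rw [hlen, ← mul_div_assoc, div_lt_iff₀ hη] at hlt
    have hneg : P.gain η x r.length < 0 := by
      simp only [Model.gain]
      linarith
    have hr : r ≠ [] := by
      rintro rfl
      exact absurd (Model.gain_zero_nonneg (P := P) (η := η) x) (not_le.2 hneg)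
    obtain ⟨q, y, t, rfl, hy, hle⟩ := Model.exists_good_later hm hη hM1 hG hr
    rw [show p ++ x :: (q ++ y :: t) = (p ++ x :: q) ++ y :: t by simp] at hb heq
    have := hG.le _ y t hb (Model.ne_zero_of_good hη hy)
    linarith
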